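/- Let $(R,\mu)$ be a measure space, and let $M_+$ be the set of all measurable functions $f : R \to [0,\infty]$. For $f \in M_+$ let $f^*(t) = \inf\{ s \in [0,\infty) : \mu(\{f > s\}) \le t \}$, $t \in [0,\infty)$ (with $\inf\emptyset = \infty$), be its non-increasing rearrangement. Assume that $(R,\mu)$ is resonant, i.e. it is $\sigma$-finite and for all $f, g \in M_+$ $$\sup\Big\{ \int_R f h \, d\mu : h \in M_+,\ h^* = g^* \Big\} = \int_0^\infty f^* g^* \, d\lambda .$$ Let $\lVert\cdot\rVert_X$ be an r.i. (rearrangement-invariant) quasi-Banach function norm over $(R,\mu)$. That is, $\lVert\cdot\rVert_X$ assigns to every measurable function $f$ a value in $[0,\infty]$ with $\lVert f \rVert_X = \lVert\, |f|\, \rVert_X$ (so it is determined by its values on $M_+$), and for all $f, g, f_n \in M_+$: - (Q1) $\lVert a f\rVert_X = a \lVert f \rVert_X$ for all $a \in [0,\infty)$; $\lVert f \rVert_X = 0$ if and only if $f = 0$ $\mu$-a.e.; and there is a constant $C \in [1,\infty)$, independent of $f$ and $g$, such that $\lVert f + g \rVert_X \le C(\lVert f \rVert_X + \lVert g \rVert_X)$;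 - (P2) if $g \le f$ $\mu$-a.e., then $\lVert g \rVert_X \le \lVert f \rVert_X$; - (P3) if $f_n \uparrow f$ $\mu$-a.e., then $\lVert f_n \rVert_X \uparrow \lVert f \rVert_X$; - (P4) $\lVert \chi_E \rVert_X < \infty$ for every measurable $E \subseteq R$ with $\mu(E) < \infty$; - (r.i.) if $f^* = g^*$, then $\lVert f \rVert_X = \lVert g \rVert_X$. Consider the following three statements: 1. $\lVert\cdot\rVert_X$ satisfies (P1): it is a norm on $M_+$, i.e. the first two properties in (Q1) hold and $\lVert f+g \rVert_X \le \lVert f \rVert_X + \lVert g \rVert_X$ for all $f, g \in M_+$. 2. The Hardy–Littlewood–Pólya principle holds for $\lVert\cdot\rVert_X$: for all $f, g \in M_+$, if $\int_0^t f^* \, d\lambda \le \int_0^t g^* \, d\lambda$ for every $t \in (0,\infty)$, then $\lVert f \rVert_X \le \lVert g \rVert_X$. 3. $\lVert\cdot\rVert_X$ satisfies (P5): for every measurable $E \subseteq R$ with $\mu(E) < \infty$ there is a constant $C_E \in [0,\infty)$ such that $\int_E f \, d\mu \le C_E \lVert f \rVert_X$ for all $f \in M_+$. Then (1) implies (2),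 and (2) implies (3). -/

import Mathlib

open MeasureTheory Set Filter Topology
open scoped ENNReal NNReal

namespace FunctionNorm

/-- The distribution function `μ_f(s) = μ {x | f x > s}` of a function `f : R → [0, ∞]`. -/
noncomputable def distrib {R : Type*} [MeasurableSpace R] (μ : Measure R) (f : R → ℝ≥0∞)
    (s : ℝ≥0∞) : ℝ≥0∞ :=
  μ {x | s < f x}

/-- The non-increasing rearrangement `f* : [0, ∞) → [0, ∞]`,
`f*(t) = inf {s ≥ 0 | μ_f(s) ≤ t}`. Since `μ_f(∞) = 0`, allowing `s = ∞` only encodes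
the convention `inf ∅ = ∞`. -/
noncomputable def rearrangement {R : Type*} [MeasurableSpace R] (μ : Measure R)
    (f : R → ℝ≥0∞) (t : ℝ≥0) : ℝ≥0∞ :=
  sInf {s : ℝ≥0∞ | distrib μ f s ≤ t}

/-- A measure space is resonant if it is σ-finite and, for all measurable `f, g`, the supremum
of `∫ f h dμ` over all measurable `h` with `h* = g*` equals `∫₀^∞ f* g* dλ`. (Only the absolute
values of the functions enter, so the functions are taken with values in `[0, ∞]`.) -/
structure IsResonant {R : Type*} [MeasurableSpace R] (μ : Measure R) : Prop where
  sigmaFinite : SigmaFinite μ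
  iSup_eq : ∀ f g : R → ℝ≥0∞, Measurable f → Measurable g →
    (⨆ h ∈ {h : R → ℝ≥0∞ | Measurable h ∧ rearrangement μ h = rearrangement μ g},
        ∫⁻ x, f x * h x ∂μ)
      = ∫⁻ t in Ioi (0 : ℝ),
          rearrangement μ f t.toNNReal * rearrangement μ g t.toNNReal

/-- (P1): on non-negative measurable functions, `ρ` is a norm, that is, it is positively
homogeneous, vanishes exactly at the functions that are zero almost everywhere, and is
subadditive. -/
structure SatisfiesP1 {R : Type*} [MeasurableSpace R] (μ : Measure R)
    (ρ : (R → ℝ≥0∞) → ℝ≥0∞) : Prop where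
  smul : ∀ (a : ℝ≥0) (f : R → ℝ≥0∞), Measurable f →
    ρ (fun x => (a : ℝ≥0∞) * f x) = (a : ℝ≥0∞) * ρ f
  eq_zero_iff : ∀ f : R → ℝ≥0∞, Measurable f → (ρ f = 0 ↔ f =ᵐ[μ] 0)
  add_le : ∀ f g : R → ℝ≥0∞, Measurable f → Measurable g →
    ρ (fun x => f x + g x) ≤ ρ f + ρ g

/-- (P5): local integrability. -/
def SatisfiesP5 {R : Type*} [MeasurableSpace R] (μ : Measure R)
    (ρ : (R → ℝ≥0∞) → ℝ≥0∞) : Prop :=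
  ∀ E : Set R, MeasurableSet E → μ E < ∞ →
    ∃ C : ℝ≥0, ∀ f : R → ℝ≥0∞, Measurable f → ∫⁻ x in E, f x ∂μ ≤ C * ρ f

/-- Quasi-Banach function norms: (Q1), i.e. `ρ` is a quasinorm, together with (P2)–(P4).
The functional is given by its values on the non-negative (extended real valued) measurable
functions; on a general measurable `f` its value is `ρ |f|`. The values of `ρ` at non-measurable
functions are irrelevant. -/
structure IsQuasiBanachFunctionNorm {R : Type*} [MeasurableSpace R] (μ : Measure R)
    (ρ : (R → ℝ≥0∞) → ℝ≥0∞) : Prop where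
  /-- (Q1)(a) positive homogeneity -/
  smul : ∀ (a : ℝ≥0) (f : R → ℝ≥0∞), Measurable f →
    ρ (fun x => (a : ℝ≥0∞) * f x) = (a : ℝ≥0∞) * ρ f
  /-- (Q1)(b) definiteness -/
  eq_zero_iff : ∀ f : R → ℝ≥0∞, Measurable f → (ρ f = 0 ↔ f =ᵐ[μ] 0)
  /-- (Q1)(c) the quasi-triangle inequality -/
  exists_add_le : ∃ C : ℝ≥0, 1 ≤ C ∧ ∀ f g : R → ℝ≥0∞, Measurable f → Measurable g →
    ρ (fun x => f x + g x) ≤ C * (ρ f + ρ g)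
  /-- (P2) the lattice property -/
  mono : ∀ f g : R → ℝ≥0∞, Measurable f → Measurable g → g ≤ᵐ[μ] f → ρ g ≤ ρ f
  /-- (P3) the Fatou property -/
  fatou : ∀ (F : ℕ → R → ℝ≥0∞) (f : R → ℝ≥0∞), (∀ n, Measurable (F n)) → Measurable f →
    (∀ᵐ x ∂μ, Monotone (fun n => F n x) ∧ Tendsto (fun n => F n x) atTop (𝓝 (f x))) →
    Monotone (fun n => ρ (F n)) ∧ Tendsto (fun n => ρ (F n)) atTop (𝓝 (ρ f))
  /-- (P4) characteristic functions of sets of finite measure have finite quasinorm -/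
  indicator_lt_top : ∀ E : Set R, MeasurableSet E → μ E < ∞ →
    ρ (E.indicator (fun _ => 1)) < ∞

/-- Rearrangement invariance: `f* = g*` implies `ρ f = ρ g`. -/
def IsRearrangementInvariant {R : Type*} [MeasurableSpace R] (μ : Measure R)
    (ρ : (R → ℝ≥0∞) → ℝ≥0∞) : Prop :=
  ∀ f g : R → ℝ≥0∞, Measurable f → Measurable g →
    rearrangement μ f = rearrangement μ g → ρ f = ρ g

/-- The Hardy–Littlewood–Pólya principle: if `∫₀ᵗ f* dλ ≤ ∫₀ᵗ g* dλ` for all `t > 0`, then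
`ρ f ≤ ρ g`. -/
def HardyLittlewoodPolya {R : Type*} [MeasurableSpace R] (μ : Measure R)
    (ρ : (R → ℝ≥0∞) → ℝ≥0∞) : Prop :=
  ∀ f g : R → ℝ≥0∞, Measurable f → Measurable g →
    (∀ t : ℝ, 0 < t →
      ∫⁻ s in Ioc 0 t, rearrangement μ f s.toNNReal
        ≤ ∫⁻ s in Ioc 0 t, rearrangement μ g s.toNNReal) →
    ρ f ≤ ρ g

end FunctionNorm

namespace FunctionNorm

variable {R : Type*} [MeasurableSpace R] {μ : Measure R}

/-! (1) ⇒ (2) is a duality argument. If `ρ g < ρ f`, the set of `u` with `ρ u ≤ ρ g` is convex and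
closed enough for Hahn–Banach to supply a weight `h ≥ 0` with `∫ f h` exceeding `∫ u h` uniformly
over that set (`exists_separating`). By Hardy–Littlewood and Hardy's lemma, `∫ f h ≤ ∫ f* h* ≤ ∫ g*
h*`. Resonance makes the last integral the supremum of `∫ k h` over `k* = g*`. Each such `k` has `ρ
k = ρ g`, a contradiction. The separation takes place in `L²`, a Hilbert space where the functional
is itself a function; truncation and the Fatou property reduce the general case to it.

(2) ⇒ (3) compares `f` with `c χ_E`, where `c` is at most the mean of `f` over `E`. Averages of `f*`
decrease, so `c χ_E` is majorized by `f`, hence `c ρ(χ_E) ≤ ρ f`. -/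

lemma rearrangement_antitone (μ : Measure R) (f : R → ℝ≥0∞) : Antitone (rearrangement μ f) :=
  fun _ _ hst => sInf_le_sInf fun _ (hr : _ ≤ _) => hr.trans (ENNReal.coe_le_coe.2 hst)

lemma antitone_rearrangement_toNNReal (μ : Measure R) (f : R → ℝ≥0∞) :
    Antitone fun t : ℝ => rearrangement μ f t.toNNReal :=
  fun _ _ hst => rearrangement_antitone μ f (Real.toNNReal_mono hst)

/-- The rearrangement of `c χ_E` is at most `c χ_[0, μ E)`. -/
lemma rearrangement_const_mul_indicator_le (μ : Measure R) (E : Set R) (c : ℝ≥0∞) (t : ℝ≥0) :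
    rearrangement μ (fun x => c * E.indicator (fun _ => 1) x) t ≤
      if (t : ℝ≥0∞) < μ E then c else 0 := by
  split_ifs with h
  · refine sInf_le ?_
    have : {x | c < c * E.indicator (fun _ => (1 : ℝ≥0∞)) x} = ∅ := by
      ext x
      by_cases hx : x ∈ E <;> simp [hx]
    simp [distrib, this]
  · refine sInf_le (le_trans (measure_mono ?_) (not_lt.mp h))
    intro x hx
    by_contra hxE
    simp [hxE] at hx

/-- The Hardy–Littlewood inequality on a resonant space. -/
lemma IsResonant.lintegral_mul_le (hμ : IsResonant μ) {f g : R → ℝ≥0∞} (hf : Measurable f)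
    (hg : Measurable g) :
    ∫⁻ x, f x * g x ∂μ ≤
      ∫⁻ t in Ioi (0 : ℝ), rearrangement μ f t.toNNReal * rearrangement μ g t.toNNReal := by
  rw [← hμ.iSup_eq f g hf hg]
  exact le_iSup₂_of_le g ⟨hg, rfl⟩ le_rfl

/-- Hardy–Littlewood with second factor `χ_E`; the factor `1 *` only matches the shape of
`rearrangement_const_mul_indicator_le`. -/
lemma IsResonant.setLIntegral_le (hμ : IsResonant μ) {f : R → ℝ≥0∞} (hf : Measurable f)
    {E : Set R} (hE : MeasurableSet E) (hEfin : μ E < ∞) :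
    ∫⁻ x in E, f x ∂μ ≤ ∫⁻ t in Ioc 0 (μ E).toReal, rearrangement μ f t.toNNReal := by
  have h1 : ∫⁻ x in E, f x ∂μ = ∫⁻ x, f x * (1 * E.indicator (fun _ => 1) x) ∂μ := by
    rw [← lintegral_indicator hE]
    refine lintegral_congr fun x => ?_
    by_cases hx : x ∈ E <;> simp [hx]
  rw [h1]
  refine (hμ.lintegral_mul_le hf
    (measurable_const.mul (measurable_const.indicator hE))).trans ?_
  rw [← lintegral_indicator measurableSet_Ioi, ← lintegral_indicator measurableSet_Ioc]
  refine lintegral_mono fun t => ?_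
  by_cases ht : t ∈ Ioi (0 : ℝ)
  · rw [indicator_of_mem ht]
    refine (mul_le_mul_right (rearrangement_const_mul_indicator_le μ E 1 _) _).trans ?_
    split_ifs with h
    · rw [indicator_of_mem, mul_one]
      refine ⟨ht, ?_⟩
      have : ENNReal.ofReal t < μ E := h
      exact ((ENNReal.ofReal_lt_iff_lt_toReal (le_of_lt ht) hEfin.ne).1 this).le
    · simp
  · simp [indicator_of_notMem ht]

/-- The averages of a non-increasing function are non-increasing. -/
lemma const_mul_le_setLIntegral_of_antitone {φ : ℝ → ℝ≥0∞} (hφ : Antitone φ) {a t : ℝ}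
    (ht : 0 < t) (hta : t ≤ a) {c : ℝ≥0}
    (hc : c * ENNReal.ofReal a ≤ ∫⁻ s in Ioc 0 a, φ s) :
    c * ENNReal.ofReal t ≤ ∫⁻ s in Ioc 0 t, φ s := by
  -- Either `φ ≥ c` on all of `(0, t]`, or `φ < c` beyond `t`; then the tail contributes at most `c
  -- (a - t)`, which can be cancelled.
  rcases le_or_gt (c : ℝ≥0∞) (φ t) with h | h
  · calc (c : ℝ≥0∞) * ENNReal.ofReal t = ∫⁻ _ in Ioc 0 t, (c : ℝ≥0∞) := by simp
      _ ≤ ∫⁻ s in Ioc 0 t, φ s :=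
        setLIntegral_mono hφ.measurable fun s hs => h.trans (hφ hs.2)
  · have h2 : ∫⁻ s in Ioc t a, φ s ≤ c * ENNReal.ofReal (a - t) := by
      calc ∫⁻ s in Ioc t a, φ s ≤ ∫⁻ _ in Ioc t a, (c : ℝ≥0∞) :=
            setLIntegral_mono measurable_const fun s hs => (hφ hs.1.le).trans h.le
        _ = _ := by simp
    have h3 : ∫⁻ s in Ioc 0 a, φ s = (∫⁻ s in Ioc 0 t, φ s) + ∫⁻ s in Ioc t a, φ s := by
      rw [← Ioc_union_Ioc_eq_Ioc ht.le hta]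
      exact lintegral_union measurableSet_Ioc
        (Ioc_disjoint_Ioc_of_le le_rfl)
    have h4 : ENNReal.ofReal a = ENNReal.ofReal t + ENNReal.ofReal (a - t) := by
      rw [← ENNReal.ofReal_add ht.le (sub_nonneg.2 hta)]; simp
    rw [h3, h4, mul_add] at hc
    exact (ENNReal.add_le_add_iff_right
      (ENNReal.mul_ne_top ENNReal.coe_ne_top ENNReal.ofReal_ne_top)).1
      (hc.trans (add_le_add le_rfl h2))

/-! ### The Hardy–Littlewood–Pólya principle implies (P5) -/

theorem HardyLittlewoodPolya.satisfiesP5 (hμ : IsResonant μ) {ρ : (R → ℝ≥0∞) → ℝ≥0∞}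
    (hρ : IsQuasiBanachFunctionNorm μ ρ) (h : HardyLittlewoodPolya μ ρ) :
    SatisfiesP5 μ ρ := by
  intro E hE hEfin
  rcases eq_or_ne (μ E) 0 with hE0 | hE0
  · exact ⟨0, fun f _ => by simp [Measure.restrict_eq_zero.2 hE0]⟩
  have hχ : Measurable (E.indicator fun _ => (1 : ℝ≥0∞)) := measurable_const.indicator hE
  have hpos : ρ (E.indicator fun _ => 1) ≠ 0 := by
    rw [Ne, hρ.eq_zero_iff _ hχ]
    intro h0
    refine hE0 (measure_mono_null (fun x hx => ?_) (ae_iff.1 h0))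
    simp [hx]
  have hfin := (hρ.indicator_lt_top E hE hEfin).ne
  have hCfin : μ E / ρ (E.indicator fun _ => 1) ≠ ∞ := ENNReal.div_ne_top hEfin.ne hpos
  refine ⟨(μ E / ρ (E.indicator fun _ => 1)).toNNReal, fun f hf => ?_⟩
  rw [ENNReal.coe_toNNReal hCfin]
  have key : ∀ c : ℝ≥0, c * μ E ≤ ∫⁻ x in E, f x ∂μ →
      c * ρ (E.indicator fun _ => 1) ≤ ρ f := by
    intro c hc
    rw [← hρ.smul c _ hχ]
    refine h _ _ (measurable_const.mul hχ) hf fun t ht => ?_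
    have hc' : c * ENNReal.ofReal (μ E).toReal ≤
        ∫⁻ s in Ioc 0 (μ E).toReal, rearrangement μ f s.toNNReal := by
      rw [ENNReal.ofReal_toReal hEfin.ne]
      exact hc.trans (hμ.setLIntegral_le hf hE hEfin)
    have ha : 0 < (μ E).toReal := ENNReal.toReal_pos hE0 hEfin.ne
    have h1 : ∫⁻ s in Ioc 0 t,
        rearrangement μ (fun x => (c : ℝ≥0∞) * E.indicator (fun _ => 1) x) s.toNNReal ≤
        c * ENNReal.ofReal (min t (μ E).toReal) := by
      calc _ ≤ ∫⁻ s in Ioc 0 t, (Iio (μ E).toReal).indicator (fun _ => (c : ℝ≥0∞)) s := by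
            refine setLIntegral_mono (measurable_const.indicator measurableSet_Iio)
              fun s hs => (rearrangement_const_mul_indicator_le μ E c _).trans ?_
            split_ifs with h
            · rw [indicator_of_mem]
              exact (ENNReal.ofReal_lt_iff_lt_toReal hs.1.le hEfin.ne).1 h
            · simp
        _ = ∫⁻ _ in Iio (μ E).toReal ∩ Ioc 0 t, (c : ℝ≥0∞) :=
            setLIntegral_indicator measurableSet_Iio _
        _ ≤ ∫⁻ _ in Ioc 0 (min t (μ E).toReal), (c : ℝ≥0∞) :=
            lintegral_mono_set fun s hs => ⟨hs.2.1, le_min hs.2.2 (le_of_lt hs.1)⟩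
        _ = _ := by simp
    exact (h1.trans (const_mul_le_setLIntegral_of_antitone
      (antitone_rearrangement_toNNReal μ f) (lt_min ht ha) (min_le_right _ _) hc')).trans
      (lintegral_mono_set (Ioc_subset_Ioc_right (min_le_left _ _)))
  -- Homogeneity covers finite scalars only and `∫_E f` may be infinite, so it is approached by
  -- finite `r`, with `c = r / μ E`.
  refine ENNReal.le_of_forall_nnreal_lt fun r hr => ?_
  have hc := key (r / μ E).toNNReal
  rw [ENNReal.coe_toNNReal (ENNReal.div_ne_top ENNReal.coe_ne_top hE0),
    ENNReal.div_mul_cancel hE0 hEfin.ne] at hc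
  calc (r : ℝ≥0∞) = μ E / ρ (E.indicator fun _ => 1) *
        (r / μ E * ρ (E.indicator fun _ => 1)) := by
        rw [mul_comm (_ / μ E), ← mul_assoc, ENNReal.div_mul_cancel hpos hfin,
          ENNReal.mul_div_cancel hE0 hEfin.ne]
    _ ≤ _ := mul_le_mul_right (hc hr.le) _

/-! ### Hardy's lemma -/

/-- Two measures on `(0, ∞)` that compare on initial intervals compare on all lower sets. -/
lemma measure_le_of_isLowerSet {ν₁ ν₂ : Measure ℝ} (h0 : ν₁ (Iic 0) = 0)
    (h : ∀ t, 0 < t → ν₁ (Ioc 0 t) ≤ ν₂ (Ioc 0 t)) {A : Set ℝ} (hA : IsLowerSet A) :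
    ν₁ A ≤ ν₂ A := by
  have hcof : ∀ t ∈ A, ν₁ (Iic t) ≤ ν₂ A := by
    intro t htA
    rcases le_or_gt t 0 with ht | ht
    · exact ((measure_mono (Iic_subset_Iic.2 ht)).trans h0.le).trans zero_le
    · rw [← Iic_union_Ioc_eq_Iic ht.le]
      refine (measure_union_le _ _).trans ?_
      rw [h0, zero_add]
      exact (h t ht).trans (measure_mono fun s hs => hA hs.2 htA)
  have hseq : ∀ u : ℕ → ℝ, Monotone u → (∀ n, u n ∈ A) → A ⊆ ⋃ n, Iic (u n) →
      ν₁ A ≤ ν₂ A := by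
    intro u hu huA hAu
    refine (measure_mono hAu).trans ?_
    rw [Monotone.measure_iUnion fun _ _ hmn => Iic_subset_Iic.2 (hu hmn)]
    exact iSup_le fun n => hcof _ (huA n)
  -- A lower set containing its supremum is a closed ray; otherwise it is exhausted by closed rays
  -- ending at points of `A`.
  rcases A.eq_empty_or_nonempty with rfl | hne
  · simp
  by_cases hbd : BddAbove A
  · by_cases hb : sSup A ∈ A
    · exact (measure_mono fun s hs => le_csSup hbd hs).trans (hcof _ hb)
    · obtain ⟨u, hu, hlt, hlim⟩ := exists_seq_strictMono_tendsto (sSup A)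
      refine hseq u hu.monotone (fun n => ?_) fun s hs => ?_
      · obtain ⟨s, hs, hsn⟩ := exists_lt_of_lt_csSup hne (hlt n)
        exact hA hsn.le hs
      · have : s < sSup A := lt_of_le_of_ne (le_csSup hbd hs) (fun h => hb (h ▸ hs))
        obtain ⟨n, hn⟩ := (hlim.eventually (lt_mem_nhds this)).exists
        exact mem_iUnion.2 ⟨n, le_of_lt hn⟩
  · refine hseq (fun n => n) Nat.mono_cast (fun n => ?_) fun s _ => ?_
    · obtain ⟨s, hs, hns⟩ := not_bddAbove_iff.1 hbd n
      exact hA hns.le hs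
    · obtain ⟨n, hn⟩ := exists_nat_ge s
      exact mem_iUnion.2 ⟨n, hn⟩

lemma iSup_min_natCast (a : ℝ≥0∞) : ⨆ n : ℕ, min a n = a := by
  have := inf_iSup_eq a fun n : ℕ => (n : ℝ≥0∞)
  rw [ENNReal.iSup_natCast, inf_top_eq] at this
  exact this.symm

lemma monotone_min_natCast (a : ℝ≥0∞) : Monotone fun n : ℕ => min a (n : ℝ≥0∞) :=
  fun _ _ h => min_le_min_left _ (Nat.cast_le.2 h)

/-- A comparison of measures on the level sets of a function carries over to its integral. -/
lemma lintegral_le_lintegral_of_measure_lt_le {α : Type*} [MeasurableSpace α]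
    {ν₁ ν₂ : Measure α} {φ : α → ℝ≥0∞} (hφ : Measurable φ)
    (h : ∀ s : ℝ≥0∞, ν₁ {x | s < φ x} ≤ ν₂ {x | s < φ x}) :
    ∫⁻ x, φ x ∂ν₁ ≤ ∫⁻ x, φ x ∂ν₂ := by
  -- The layer-cake formula is for real-valued functions, hence the cut-off at height `n`.
  have hm : ∀ n : ℕ, Measurable fun x => min (φ x) n := fun n => hφ.min measurable_const
  have key : ∀ n : ℕ, ∫⁻ x, min (φ x) n ∂ν₁ ≤ ∫⁻ x, min (φ x) n ∂ν₂ := by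
    intro n
    have hlayer : ∀ ν : Measure α, ∫⁻ x, min (φ x) n ∂ν =
        ∫⁻ t in Ioi (0 : ℝ), ν {x | t < (min (φ x) n).toReal} := by
      intro ν
      rw [← lintegral_eq_lintegral_meas_lt ν (ae_of_all _ fun _ => ENNReal.toReal_nonneg)
        (hm n).ennreal_toReal.aemeasurable]
      exact lintegral_congr fun x => (ENNReal.ofReal_toReal
        (ne_top_of_le_ne_top (ENNReal.natCast_ne_top n) (min_le_right _ _))).symm
    rw [hlayer, hlayer]
    refine setLIntegral_mono' measurableSet_Ioi fun t ht => ?_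
    have hset : {x | t < (min (φ x) n).toReal} =
        {x | ENNReal.ofReal t < φ x ∧ ENNReal.ofReal t < n} := by
      ext x
      rw [mem_ofPred_eq, mem_ofPred_eq, ← lt_min_iff, ENNReal.ofReal_lt_iff_lt_toReal (le_of_lt ht)
        (ne_top_of_le_ne_top (ENNReal.natCast_ne_top n) (min_le_right _ _))]
    rw [hset]
    by_cases hn : ENNReal.ofReal t < n
    · simpa [hn] using h (ENNReal.ofReal t)
    · simp [hn]
  have hsup : ∀ ν : Measure α, ∫⁻ x, φ x ∂ν = ⨆ n : ℕ, ∫⁻ x, min (φ x) n ∂ν := by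
    intro ν
    rw [← lintegral_iSup hm fun _ _ hij x => monotone_min_natCast (φ x) hij]
    simp_rw [iSup_min_natCast]
  rw [hsup, hsup]
  exact iSup_mono key

/-- Hardy's lemma. -/
lemma lintegral_mul_le_of_antitone {F G φ : ℝ → ℝ≥0∞} (hF : Measurable F) (hG : Measurable G)
    (hφ : Antitone φ)
    (h : ∀ t : ℝ, 0 < t → ∫⁻ s in Ioc 0 t, F s ≤ ∫⁻ s in Ioc 0 t, G s) :
    ∫⁻ s in Ioi (0 : ℝ), F s * φ s ≤ ∫⁻ s in Ioi (0 : ℝ), G s * φ s := by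
  have hd : ∀ {H : ℝ → ℝ≥0∞}, Measurable H → ∫⁻ s in Ioi (0 : ℝ), H s * φ s =
      ∫⁻ s, φ s ∂(volume.restrict (Ioi 0)).withDensity H := fun hH =>
    (lintegral_withDensity_eq_lintegral_mul _ hH hφ.measurable).symm
  have hI : ∀ (H : ℝ → ℝ≥0∞) (t : ℝ),
      (volume.restrict (Ioi 0)).withDensity H (Ioc 0 t) = ∫⁻ s in Ioc 0 t, H s := by
    intro H t
    rw [withDensity_apply _ measurableSet_Ioc, Measure.restrict_restrict measurableSet_Ioc,
      inter_eq_left.2 fun s hs => hs.1]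
  rw [hd hF, hd hG]
  refine lintegral_le_lintegral_of_measure_lt_le hφ.measurable fun s =>
    measure_le_of_isLowerSet ?_ (fun t ht => ?_) fun a b hba ha => lt_of_lt_of_le ha (hφ hba)
  · rw [withDensity_apply _ measurableSet_Iic, Measure.restrict_restrict measurableSet_Iic]
    rw [Iic_inter_Ioi, Ioc_self, Measure.restrict_empty, lintegral_zero_measure]
  · rw [hI, hI]
    exact h t ht

/-! ### Sublevel sets of `ρ` and their separation in `L²` -/

variable {ρ : (R → ℝ≥0∞) → ℝ≥0∞}

/-- Sublevel sets of a quasi-Banach function norm are closed under convergence almost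
everywhere. -/
lemma IsQuasiBanachFunctionNorm.le_of_tendsto (hρ : IsQuasiBanachFunctionNorm μ ρ)
    {u : ℕ → R → ℝ≥0∞} {v : R → ℝ≥0∞} (hu : ∀ n, Measurable (u n)) (hv : Measurable v)
    {r : ℝ≥0∞} (hr : ∀ n, ρ (u n) ≤ r)
    (hlim : ∀ᵐ x ∂μ, Tendsto (fun n => u n x) atTop (𝓝 (v x))) : ρ v ≤ r := by
  -- The tail infima increase to the liminf, which is `v` almost everywhere, so the Fatou property
  -- applies to them.
  have hm : ∀ n, Measurable fun x => ⨅ i, u (i + n) x := fun n => .iInf fun i => hu (i + n)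
  have hmono : ∀ x, Monotone fun n => ⨅ i, u (i + n) x := fun x m n hmn =>
    le_iInf fun i => (iInf_le _ (i + (n - m))).trans_eq (by
      rw [show i + (n - m) + m = i + n by omega])
  refine le_of_tendsto' (hρ.fatou (fun n x => ⨅ i, u (i + n) x) v hm hv ?_).2 fun n =>
    (hρ.mono (u n) _ (hu n) (hm n) (ae_of_all _ fun x => ?_)).trans (hr n)
  · filter_upwards [hlim] with x hx
    refine ⟨hmono x, ?_⟩
    rw [← hx.liminf_eq, liminf_eq_iSup_iInf_of_nat']
    exact tendsto_atTop_iSup (hmono x)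
  · exact (iInf_le _ 0).trans_eq (by rw [zero_add])

/-- The truncation of a function in height and to a set of finite measure. -/
noncomputable def truncation (μ : Measure R) [SigmaFinite μ] (u : R → ℝ≥0∞) (n : ℕ) :
    R → ℝ≥0∞ :=
  (spanningSets μ n).indicator fun x => min (u x) n

section Truncation

variable [SigmaFinite μ] {u : R → ℝ≥0∞}

lemma measurable_truncation (hu : Measurable u) (n : ℕ) : Measurable (truncation μ u n) :=
  (hu.min measurable_const).indicator (measurableSet_spanningSets μ n)

lemma truncation_le (u : R → ℝ≥0∞) (n : ℕ) (x : R) : truncation μ u n x ≤ u x :=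
  indicator_le_self' (fun _ _ => zero_le) x |>.trans (min_le_left _ _)

lemma truncation_le_natCast (u : R → ℝ≥0∞) (n : ℕ) (x : R) : truncation μ u n x ≤ n :=
  indicator_le_self' (fun _ _ => zero_le) x |>.trans (min_le_right _ _)

lemma truncation_ne_top (u : R → ℝ≥0∞) (n : ℕ) (x : R) : truncation μ u n x ≠ ∞ :=
  ne_top_of_le_ne_top (ENNReal.natCast_ne_top n) (truncation_le_natCast u n x)

lemma monotone_truncation (u : R → ℝ≥0∞) : Monotone (truncation μ u) := fun _ _ hmn x =>
  indicator_le_indicator_of_subset (monotone_spanningSets μ hmn) (fun _ => zero_le) x |>.trans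
    (indicator_le_indicator (monotone_min_natCast (u x) hmn))

lemma iSup_truncation (u : R → ℝ≥0∞) (x : R) : ⨆ n, truncation μ u n x = u x := by
  refine le_antisymm (iSup_le fun n => truncation_le u n x) ?_
  obtain ⟨k, hk⟩ := mem_iUnion.1 ((iUnion_spanningSets μ).ge (mem_univ x))
  rw [← iSup_min_natCast (u x)]
  refine iSup_le fun n => le_iSup_of_le (max k n) ?_
  rw [truncation, indicator_of_mem (monotone_spanningSets μ (le_max_left k n) hk)]
  exact monotone_min_natCast (u x) (le_max_right k n)

lemma tendsto_truncation (u : R → ℝ≥0∞) (x : R) :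
    Tendsto (fun n => truncation μ u n x) atTop (𝓝 (u x)) := by
  rw [← iSup_truncation (μ := μ) u x]
  exact tendsto_atTop_iSup fun _ _ h => monotone_truncation u h x

lemma memLp_truncation (hu : Measurable u) (n : ℕ) :
    MemLp (fun x => (truncation μ u n x).toReal) 2 μ := by
  have : (fun x => (truncation μ u n x).toReal) =
      (spanningSets μ n).indicator fun x => (truncation μ u n x).toReal := by
    ext x
    by_cases hx : x ∈ spanningSets μ n <;> simp [truncation, hx]
  rw [this, memLp_indicator_iff_restrict (measurableSet_spanningSets μ n)]
  have : IsFiniteMeasure (μ.restrict (spanningSets μ n)) :=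
    isFiniteMeasure_restrict.2 (measure_spanningSets_lt_top μ n).ne
  refine .of_bound (measurable_truncation hu n).ennreal_toReal.aestronglyMeasurable n
    (ae_of_all _ fun x => ?_)
  rw [Real.norm_of_nonneg ENNReal.toReal_nonneg]
  exact ENNReal.toReal_le_of_le_ofReal n.cast_nonneg
    (by simpa using truncation_le_natCast u n x)

end Truncation

lemma measurable_ofReal_coeFn (u : Lp ℝ 2 μ) : Measurable fun x => ENNReal.ofReal (u x) :=
  (Lp.stronglyMeasurable u).measurable.ennreal_ofReal

/-- An `L²`-convergent sequence has an a.e. convergent subsequence. Here `ENNReal.ofReal` takes the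
positive part. -/
lemma IsQuasiBanachFunctionNorm.isClosed_sublevel (hρ : IsQuasiBanachFunctionNorm μ ρ)
    (r : ℝ≥0∞) : IsClosed {u : Lp ℝ 2 μ | ρ (fun x => ENNReal.ofReal (u x)) ≤ r} := by
  refine IsSeqClosed.isClosed fun u v hu huv => ?_
  obtain ⟨φ, -, hφ⟩ := (tendstoInMeasure_of_tendsto_Lp huv).exists_seq_tendsto_ae
  refine hρ.le_of_tendsto (fun n => measurable_ofReal_coeFn (u (φ n)))
    (measurable_ofReal_coeFn v) (fun n => hu (φ n)) ?_
  filter_upwards [hφ] with x hx using (ENNReal.continuous_ofReal.tendsto _).comp hx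

/-- The positive part is sublinear and `ρ` is monotone and, by (P1), subadditive with constant one.
-/
lemma IsQuasiBanachFunctionNorm.convex_sublevel (hρ : IsQuasiBanachFunctionNorm μ ρ)
    (hP1 : SatisfiesP1 μ ρ) (r : ℝ≥0∞) :
    Convex ℝ {u : Lp ℝ 2 μ | ρ (fun x => ENNReal.ofReal (u x)) ≤ r} := by
  intro u hu v hv a b ha hb hab
  have hmu := measurable_ofReal_coeFn u
  have hmv := measurable_ofReal_coeFn v
  calc ρ (fun x => ENNReal.ofReal ((a • u + b • v : Lp ℝ 2 μ) x))
      ≤ ρ (fun x => a.toNNReal * ENNReal.ofReal (u x) + b.toNNReal * ENNReal.ofReal (v x)) := by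
        refine hρ.mono _ _ ((hmu.const_mul _).add (hmv.const_mul _))
          (measurable_ofReal_coeFn _) ?_
        filter_upwards [Lp.coeFn_add (a • u) (b • v), Lp.coeFn_smul a u, Lp.coeFn_smul b v]
          with x h1 h2 h3
        rw [h1, Pi.add_apply, h2, h3, Pi.smul_apply, Pi.smul_apply, smul_eq_mul, smul_eq_mul]
        refine ENNReal.ofReal_add_le.trans_eq ?_
        rw [ENNReal.ofReal_mul ha, ENNReal.ofReal_mul hb]
        rfl
    _ ≤ a.toNNReal * ρ (fun x => ENNReal.ofReal (u x)) +
          b.toNNReal * ρ (fun x => ENNReal.ofReal (v x)) := by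
        rw [← hP1.smul _ _ hmu, ← hP1.smul _ _ hmv]
        exact hP1.add_le _ _ (hmu.const_mul _) (hmv.const_mul _)
    _ ≤ a.toNNReal * r + b.toNNReal * r := by
        gcongr
        exacts [hu, hv]
    _ = r := by
        rw [← add_mul, ← ENNReal.coe_add, ← Real.toNNReal_add ha hb, hab]
        simp

/-- If `ρ` is a norm, then its sublevel sets are intersections of half-spaces
`{u | ∫ u h ≤ s}` with `h ≥ 0`. -/
lemma IsQuasiBanachFunctionNorm.exists_separating [SigmaFinite μ]
    (hρ : IsQuasiBanachFunctionNorm μ ρ) (hP1 : SatisfiesP1 μ ρ) {f : R → ℝ≥0∞}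
    (hf : Measurable f) {r : ℝ≥0∞} (hr : r < ρ f) :
    ∃ (h : R → ℝ≥0∞) (s : ℝ≥0∞), Measurable h ∧
      (∀ u : R → ℝ≥0∞, Measurable u → ρ u ≤ r → ∫⁻ x, u x * h x ∂μ ≤ s) ∧
      s < ∫⁻ x, f x * h x ∂μ := by
  obtain ⟨n, hn⟩ : ∃ n, r < ρ (truncation μ f n) := by
    by_contra! hcon
    exact hr.not_ge (hρ.le_of_tendsto (measurable_truncation hf) hf hcon
      (ae_of_all _ (tendsto_truncation f)))
  set v : Lp ℝ 2 μ := (memLp_truncation hf n).toLp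
  have hvx : ∀ᵐ x ∂μ, v x = (truncation μ f n x).toReal := MemLp.coeFn_toLp _
  have hfn : v ∉ {u : Lp ℝ 2 μ | ρ (fun x => ENNReal.ofReal (u x)) ≤ r} := by
    rw [mem_ofPred_eq, not_le]
    refine hn.trans_le (hρ.mono _ _ (measurable_ofReal_coeFn _) (measurable_truncation hf n) ?_)
    filter_upwards [hvx] with x hx
    rw [hx, ENNReal.ofReal_toReal (truncation_ne_top f n x)]
  obtain ⟨l, s, hls, hlf⟩ := geometric_hahn_banach_closed_point (hρ.convex_sublevel hP1 r)
    (hρ.isClosed_sublevel r) hfn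
  set h : Lp ℝ 2 μ := (InnerProductSpace.toDual ℝ (Lp ℝ 2 μ)).symm l
  have hl : ∀ u : Lp ℝ 2 μ, l u = ∫ x, u x * h x ∂μ := fun u => by
    rw [← InnerProductSpace.toDual_symm_apply, L2.inner_def]
    rfl
  have hint : ∀ u : Lp ℝ 2 μ, Integrable (fun x => u x * h x) μ := fun u =>
    L2.integrable_inner (𝕜 := ℝ) h u
  have hhm : Measurable h := (Lp.stronglyMeasurable h).measurable
  have hs : 0 ≤ s := by
    have h0 : ρ (fun x => ENNReal.ofReal ((0 : Lp ℝ 2 μ) x)) = 0 := by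
      rw [hρ.eq_zero_iff _ (measurable_ofReal_coeFn _)]
      filter_upwards [Lp.coeFn_zero ℝ 2 μ] with x hx
      rw [hx]
      simp
    simpa using (hls 0 (h0.trans_le zero_le)).le
  -- The weight is the positive part of the Riesz representative of `l`.
  refine ⟨fun x => ENNReal.ofReal (h x), ENNReal.ofReal s, hhm.ennreal_ofReal,
    fun u hu hur => ?_, ?_⟩
  · have hsup : ∫⁻ x, u x * ENNReal.ofReal (h x) ∂μ =
        ⨆ n, ∫⁻ x, truncation μ u n x * ENNReal.ofReal (h x) ∂μ := by
      have := lintegral_iSup (μ := μ) (f := fun n x => truncation μ u n x * ENNReal.ofReal (h x))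
        (fun n => (measurable_truncation hu n).mul hhm.ennreal_ofReal)
        fun _ _ hij x => mul_le_mul_left (monotone_truncation u hij x) _
      simpa only [← ENNReal.iSup_mul, iSup_truncation] using this
    rw [hsup]
    refine iSup_le fun n => ?_
    have hP : MeasurableSet {x | 0 < h x} := measurableSet_lt measurable_const hhm
    -- Cutting `u` down to `{h > 0}` keeps it in the sublevel set and turns `∫ w h` into the
    -- integral against the positive part of `h`.
    set w := ((memLp_truncation (μ := μ) hu n).indicator hP).toLp
    have hwx : ∀ᵐ x ∂μ, w x = {x | 0 < h x}.indicator
        (fun x => (truncation μ u n x).toReal) x := MemLp.coeFn_toLp _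
    have hlw : l w < s := by
      refine hls w ((hρ.mono _ _ hu (measurable_ofReal_coeFn w) ?_).trans hur)
      filter_upwards [hwx] with x hx
      rw [hx]
      by_cases hxP : x ∈ {x | 0 < h x}
      · rw [indicator_of_mem hxP, ENNReal.ofReal_toReal (truncation_ne_top u n x)]
        exact truncation_le u n x
      · rw [indicator_of_notMem hxP]; simp
    have hpt : ∀ᵐ x ∂μ, 0 ≤ w x * h x ∧
        truncation μ u n x * ENNReal.ofReal (h x) = ENNReal.ofReal (w x * h x) := by
      filter_upwards [hwx] with x hx
      rw [hx]
      by_cases hxP : x ∈ {x | 0 < h x}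
      · rw [indicator_of_mem hxP, ENNReal.ofReal_mul ENNReal.toReal_nonneg,
          ENNReal.ofReal_toReal (truncation_ne_top u n x)]
        exact ⟨mul_nonneg ENNReal.toReal_nonneg (le_of_lt hxP), rfl⟩
      · rw [indicator_of_notMem hxP, ENNReal.ofReal_of_nonpos (not_lt.1 hxP)]
        simp
    rw [lintegral_congr_ae (hpt.mono fun _ hx => hx.2),
      ← ofReal_integral_eq_lintegral_ofReal (hint w) (hpt.mono fun _ hx => hx.1), ← hl]
    exact ENNReal.ofReal_le_ofReal hlw.le
  · rw [hl] at hlf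
    calc ENNReal.ofReal s
        < ENNReal.ofReal (∫ x, v x * h x ∂μ) :=
          (ENNReal.ofReal_lt_ofReal_iff (hs.trans_lt hlf)).2 hlf
      _ ≤ ENNReal.ofReal (∫ x, max (v x * h x) 0 ∂μ) :=
          ENNReal.ofReal_le_ofReal (integral_mono (hint _) (hint _).pos_part
            fun x => le_max_left _ _)
      _ = ∫⁻ x, ENNReal.ofReal (max (v x * h x) 0) ∂μ :=
          ofReal_integral_eq_lintegral_ofReal (hint _).pos_part
            (ae_of_all _ fun x => le_max_right _ _)
      _ ≤ ∫⁻ x, f x * ENNReal.ofReal (h x) ∂μ := by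
          refine lintegral_mono_ae ?_
          filter_upwards [hvx] with x hx
          rw [hx, ENNReal.ofReal_max, ENNReal.ofReal_zero, max_eq_left zero_le,
            ENNReal.ofReal_mul ENNReal.toReal_nonneg,
            ENNReal.ofReal_toReal (truncation_ne_top f n x)]
          exact mul_le_mul_left (truncation_le f n x) _

/-! ### (P1) implies the Hardy–Littlewood–Pólya principle -/

theorem SatisfiesP1.hardyLittlewoodPolya (hμ : IsResonant μ)
    (hρ : IsQuasiBanachFunctionNorm μ ρ) (hri : IsRearrangementInvariant μ ρ)
    (hP1 : SatisfiesP1 μ ρ) : HardyLittlewoodPolya μ ρ := by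
  intro f g hf hg hfg
  have := hμ.sigmaFinite
  by_contra! hlt
  obtain ⟨h, s, hh, hs, hfs⟩ := hρ.exists_separating hP1 hf hlt
  refine hfs.not_ge ?_
  calc ∫⁻ x, f x * h x ∂μ
      ≤ ∫⁻ t in Ioi (0 : ℝ), rearrangement μ f t.toNNReal * rearrangement μ h t.toNNReal :=
        hμ.lintegral_mul_le hf hh
    _ ≤ ∫⁻ t in Ioi (0 : ℝ), rearrangement μ g t.toNNReal * rearrangement μ h t.toNNReal :=
        lintegral_mul_le_of_antitone (antitone_rearrangement_toNNReal μ f).measurable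
          (antitone_rearrangement_toNNReal μ g).measurable
          (antitone_rearrangement_toNNReal μ h) hfg
    _ = ⨆ k ∈ {k : R → ℝ≥0∞ | Measurable k ∧ rearrangement μ k = rearrangement μ g},
          ∫⁻ x, h x * k x ∂μ := by
        rw [hμ.iSup_eq h g hh hg]
        simp_rw [mul_comm]
    _ ≤ s := by
        refine iSup₂_le fun k hk => ?_
        simp_rw [mul_comm (h _)]
        exact hs k hk.1 (hri k g hk.1 hg hk.2).le

end FunctionNorm

theorem proposition3p1 {R : Type*} [MeasurableSpace R] (μ : Measure R)
    (hμ : FunctionNorm.IsResonant μ) (ρ : (R → ℝ≥0∞) → ℝ≥0∞)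
    (hρ : FunctionNorm.IsQuasiBanachFunctionNorm μ ρ)
    (hri : FunctionNorm.IsRearrangementInvariant μ ρ) :
    (FunctionNorm.SatisfiesP1 μ ρ → FunctionNorm.HardyLittlewoodPolya μ ρ) ∧
      (FunctionNorm.HardyLittlewoodPolya μ ρ → FunctionNorm.SatisfiesP5 μ ρ) :=
  ⟨fun h => h.hardyLittlewoodPolya hμ hρ hri, fun h => h.satisfiesP5 hμ hρ⟩
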